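/- Let $T=(V,E)$ be a finite tree with $|V|=p\ge 2$. Let $\mathbf a=(a_i)_{i\in V}$ with all $a_i>0$, and let $\mathbf C=[c_{i,j}]_{i,j\in V}$ be a symmetric real matrix with $c_i:=c_{i,i}>0$ for all $i\in V$, $c_{i,j}>0$ if $\{i,j\}\in E$, and $c_{i,j}=0$ otherwise. The tree-Kummer distribution $\mathrm{TK}(\mathbf a,\mathbf C)$ is the probability distribution on $\mathbb R^V$ with density $$ f(\mathbf x)\;\propto\;\prod_{i\in V}x_i^{a_i-1}\,\exp\Big(-\sum_{S\subseteq T}\ \prod_{i\in V(S)}\frac{x_i}{c_i^{\deg_S(i)-1}}\prod_{\{j,k\}\in E(S)}c_{j,k}\Big)\,\mathbf 1_{(0,\infty)^V}(\mathbf x), $$ where the sum runs over all subtrees $S$ of $T$, that is, over all non-empty connected induced subgraphs $S=(V(S),E(S))$ of $T$ (one-vertex subtrees, with $\deg_S(i)=0$, included). For $r\in V$ direct $T$ away from the root $r$; let $\mathfrak C_r(i)$ be the set of children of $i$ and, for $i\ne r$, let $\mathfrak p_r(i)$ be the parent of $i$. Define $\Phi_r(s_i,\,i\in V)=(s_{i,(r)},\,i\in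 V)$ recursively, starting from the vertices farthest from $r$, by $$ s_{i,(r)}=s_i\prod_{j\in\mathfrak C_r(i)}\Big(1+\frac{c_{i,j}}{c_i}\,s_{j,(r)}\Big), $$ an empty product being $1$. For $\alpha,\gamma>0$ and $\beta\in\mathbb R$, let $\mathcal G(\alpha,\gamma)$ be the Gamma distribution with density $\propto x^{\alpha-1}e^{-\gamma x}\mathbf 1_{(0,\infty)}(x)$ and $\mathcal K(\alpha,\beta,\gamma)$ the Kummer distribution with density $\propto \dfrac{x^{\alpha-1}}{(1+x)^{\alpha+\beta}}e^{-\gamma x}\mathbf 1_{(0,\infty)}(x)$. Let $\mathbf S=(S_i)_{i\in V}$ be a random vector with distribution $\mathrm{TK}(\mathbf a,\mathbf C)$. Then for every $r\in V$ the components of the random vector $(X_{i,(r)})_{i\in V}=\Phi_r(\mathbf S)$ are independent. Moreover, $$ X_{r,(r)}\sim\mathcal G(a_r,c_r) \quad\text{and}\quad \frac{c_{\mathfrak p_r(i),i}}{c_{\mathfrak p_r(i)}}\,X_{i,(r)}\sim\mathcal K\Big(a_i,\;a_{\mathfrak p_r(i)}-a_i,\;\frac{c_{\mathfrak p_r(i)}\,c_i}{c_{\mathfrak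 p_r(i),i}}\Big)\quad\text{for all } i\in V\setminus\{r\}. $$ -/

import Mathlib

open MeasureTheory ProbabilityTheory
open scoped ENNReal

noncomputable section

namespace TreeKummer

/-- The probability measure whose density with respect to `ν` is proportional to `f`
(the zero measure if `f` cannot be normalized). -/
def densityPropTo {X : Type*} [MeasurableSpace X] (ν : Measure X) (f : X → ℝ) : Measure X :=
  (∫⁻ x, ENNReal.ofReal (f x) ∂ν)⁻¹ • ν.withDensity (fun x => ENNReal.ofReal (f x))

/-- Unnormalized density of the Kummer distribution `K(α, β, γ)`. -/
def kummerWeight (α β γ x : ℝ) : ℝ :=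
  (Set.Ioi (0 : ℝ)).indicator
    (fun x => x ^ (α - 1) / (1 + x) ^ (α + β) * Real.exp (-(γ * x))) x

/-- The Kummer distribution `K(α, β, γ)`. -/
def kummerMeasure (α β γ : ℝ) : Measure ℝ :=
  densityPropTo volume (kummerWeight α β γ)

/-- The set `C_T`: symmetric matrices indexed by the vertices, positive on the diagonal and on the
edges of `T`, and zero elsewhere. -/
structure TreeMatrix {V : Type*} (T : SimpleGraph V) where
  c : Matrix V V ℝ
  isSymm : c.IsSymm
  diag_pos : ∀ i, 0 < c i i
  edge_pos : ∀ i j, T.Adj i j → 0 < c i j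
  eq_zero : ∀ i j, i ≠ j → ¬ T.Adj i j → c i j = 0

/-- The weight `c_{j,k}` of the unordered pair `{j, k}`. -/
def TreeMatrix.edgeWeight {V : Type*} {T : SimpleGraph V} (C : TreeMatrix T) : Sym2 V → ℝ :=
  Sym2.lift ⟨fun j k => C.c j k, fun j k => C.isSymm.apply k j⟩

section Finite

variable {V : Type*} [Fintype V]

open Classical in
/-- The vertex sets `A` of the subtrees of `T`; the subtree on `A` is the graph induced by `T`
(being a tree, it is connected, and `A` is not empty). -/
def subtrees (T : SimpleGraph V) : Finset (Finset V) :=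
  Finset.univ.filter fun A => (T.induce (A : Set V)).IsTree

open Classical in
/-- The degree of the vertex `i` of `A` in the subgraph induced on `A`. -/
def degIn (T : SimpleGraph V) (A : Finset V) (i : V) : ℕ :=
  (A.filter fun l => T.Adj l i).card

open Classical in
/-- The edges of the subgraph induced on `A`. -/
def edgesIn (T : SimpleGraph V) (A : Finset V) : Finset (Sym2 V) :=
  T.edgeFinset.filter fun e => ∀ v ∈ e, v ∈ A

/-- The sum over all subtrees in the exponent of the tree-Kummer density. The exponent
`deg - 1` is an integer, equal to `-1` for one-vertex subtrees. -/
def treeEnergy (T : SimpleGraph V) (C : TreeMatrix T) (x : V → ℝ) : ℝ :=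
  ∑ A ∈ subtrees T,
    (∏ i ∈ A, x i / C.c i i ^ ((degIn T A i : ℤ) - 1)) * ∏ e ∈ edgesIn T A, C.edgeWeight e

/-- Unnormalized density of the tree-Kummer distribution `TK(a, C)`. -/
def treeKummerWeight (T : SimpleGraph V) (a : V → ℝ) (C : TreeMatrix T) (x : V → ℝ) : ℝ :=
  {x : V → ℝ | ∀ i, 0 < x i}.indicator
    (fun x => (∏ i, x i ^ (a i - 1)) * Real.exp (-treeEnergy T C x)) x

/-- The tree-Kummer distribution `TK(a, C)` on `(0, ∞)^V`. -/
def treeKummerMeasure (T : SimpleGraph V) (a : V → ℝ) (C : TreeMatrix T) : Measure (V → ℝ) :=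
  densityPropTo volume (treeKummerWeight T a C)

open Classical in
/-- The children of `i` when `T` is directed away from the root `r`. -/
def children (T : SimpleGraph V) (r i : V) : Finset V :=
  Finset.univ.filter fun j => T.Adj i j ∧ T.dist r j = T.dist r i + 1

lemma mem_children {T : SimpleGraph V} {r i j : V} :
    j ∈ children T r i ↔ T.Adj i j ∧ T.dist r j = T.dist r i + 1 := by
  simp [children]

/-- In a tree rooted at `r`, every vertex but the root has exactly one parent. -/
lemma existsUnique_parent {T : SimpleGraph V} (hT : T.IsTree) {r i : V} (hi : i ≠ r) :
    ∃! j, i ∈ children T r j := by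
  obtain ⟨p, hp⟩ := hT.connected.exists_walk_length_eq_dist i r
  cases p with
  | nil => exact absurd rfl hi
  | @cons _ j _ h q =>
    have h1 : T.dist j r ≤ q.length := SimpleGraph.dist_le q
    have h2 : T.dist i r ≤ T.dist i j + T.dist j r := hT.connected.dist_triangle
    have h3 : T.dist i j = 1 := SimpleGraph.dist_eq_one_iff_adj.mpr h
    rw [SimpleGraph.Walk.length_cons] at hp
    have h4 : T.dist i r = T.dist j r + 1 := by omega
    have hpath : (SimpleGraph.Walk.cons h q).IsPath :=
      SimpleGraph.Walk.isPath_of_length_eq_dist _ (by simpa using hp)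
    refine ⟨j, mem_children.2 ⟨h.symm, ?_⟩, ?_⟩
    · rw [T.dist_comm (u := r), T.dist_comm (u := r)]; exact h4
    · intro k hk
      obtain ⟨hk1, hk2⟩ := mem_children.1 hk
      rw [T.dist_comm (u := r), T.dist_comm (u := r)] at hk2
      obtain ⟨q', hq'⟩ := hT.connected.exists_walk_length_eq_dist k r
      have hpath' : (SimpleGraph.Walk.cons hk1.symm q').IsPath :=
        SimpleGraph.Walk.isPath_of_length_eq_dist _ (by
          rw [SimpleGraph.Walk.length_cons]; omega)
      have := (hT.existsUnique_path i r).unique hpath' hpath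
      simpa using congrArg SimpleGraph.Walk.snd this

/-- The parent of `i ≠ r` in the tree `T` directed away from the root `r`. -/
def parent {T : SimpleGraph V} (hT : T.IsTree) (r i : V) (hi : i ≠ r) : V :=
  (existsUnique_parent hT hi).choose

/-- The components `s_{i,(r)} = s_i ∏_{j ∈ children(i)} (1 + (c_{i,j} / c_i) s_{j,(r)})` of the
transformation `Φ_r`, defined recursively from the vertices farthest from the root. -/
def phi (T : SimpleGraph V) (C : TreeMatrix T) (r : V) (s : V → ℝ) (i : V) : ℝ :=
  s i * ∏ j : {j // j ∈ children T r i}, (1 + C.c i j / C.c i i * phi T C r s j)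
termination_by Finset.univ.sup (T.dist r) - T.dist r i
decreasing_by
  have h1 := (mem_children.1 j.2).2
  have h2 : T.dist r j.1 ≤ Finset.univ.sup (T.dist r) := Finset.le_sup (Finset.mem_univ j.1)
  omega

lemma phi_eq (T : SimpleGraph V) (C : TreeMatrix T) (r : V) (s : V → ℝ) (i : V) :
    phi T C r s i = s i * ∏ j ∈ children T r i, (1 + C.c i j / C.c i i * phi T C r s j) := by
  rw [phi, Finset.prod_coe_sort (children T r i)
    (fun j => 1 + C.c i j / C.c i i * phi T C r s j)]

end Finite

end TreeKummer

end

/-! In the coordinates `y = Φ_r(s)` the tree-Kummer density is a product of functions of one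
coordinate each. Three facts give this.

Energy: every subtree has a unique vertex `i` nearest to `r`. Unrolling the recursion for
`s_{i,(r)}` and expanding the products chooses, child by child, whether the subtree continues there,
so the subtrees topped at `i` contribute exactly `c_i s_{i,(r)}`, and the exponent is linear in `y`
(`treeEnergy_eq_sum_phi`).

Jacobian: the inverse is explicit, `s_i = y_i / F_i(y)`, where `F_i` is the product over the
children of `i` and involves only strictly deeper coordinates. Hence the Jacobian matrix is
triangular in depth, with determinant `∏ F_i⁻¹` (`det_fderiv_phiInv`).

Regrouping: Jacobian and powers together give `F_i ^ (-a_i)`. Each `j ≠ r` occurs in one `F_i` only,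
that of its parent, so the factor `(1 + κ y_j) ^ (-a_i)` can be assigned to `j`
(`jacobian_mul_weight`).

Each factor is integrable, which yields a product law (`map_phi_treeKummerMeasure`). At the root `κ
= 0` and the factor is a Gamma density; elsewhere rescaling by `κ` gives a Kummer density. -/

open MeasureTheory ProbabilityTheory
open scoped ENNReal

noncomputable section

namespace TreeKummer

/-! ### Rooted trees: parents, subtrees by top vertex, expansion of the recursion -/

section Combinatorics

variable {V : Type*} [Fintype V] {T : SimpleGraph V} {r i j k : V}

lemma dist_of_mem_children (h : j ∈ children T r i) : T.dist r j = T.dist r i + 1 :=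
  (mem_children.1 h).2

lemma ne_root_of_mem_children (h : j ∈ children T r i) : j ≠ r := by
  rintro rfl
  have := dist_of_mem_children h
  simp at this

lemma eq_of_mem_children (hT : T.IsTree) (hi : k ∈ children T r i) (hj : k ∈ children T r j) :
    i = j :=
  (existsUnique_parent hT (ne_root_of_mem_children hi)).unique hi hj

lemma mem_children_parent (hT : T.IsTree) (hi : i ≠ r) : i ∈ children T r (parent hT r i hi) :=
  (existsUnique_parent hT hi).choose_spec.1

lemma mem_children_or_of_adj (hT : T.IsTree) (r : V) (h : T.Adj i j) :
    j ∈ children T r i ∨ i ∈ children T r j := by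
  rcases hT.dist_eq_dist_add_one_of_adj r h with h' | h'
  · exact Or.inr (mem_children.2 ⟨h.symm, h'⟩)
  · exact Or.inl (mem_children.2 ⟨h, h'⟩)

/-- The parent of `i`, extended by `r` at the root. -/
def parentOrRoot (hT : T.IsTree) (r i : V) : V :=
  open Classical in if h : i = r then r else parent hT r i h

lemma parentOrRoot_of_ne (hT : T.IsTree) (hi : i ≠ r) :
    parentOrRoot hT r i = parent hT r i hi := by
  simp [parentOrRoot, hi]

lemma parentOrRoot_of_mem (hT : T.IsTree) (h : j ∈ children T r i) :
    parentOrRoot hT r j = i := by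
  have hj := ne_root_of_mem_children h
  rw [parentOrRoot_of_ne hT hj]
  exact eq_of_mem_children hT (mem_children_parent hT hj) h

lemma mem_children_iff (hT : T.IsTree) :
    j ∈ children T r i ↔ j ≠ r ∧ parentOrRoot hT r j = i := by
  refine ⟨fun h => ⟨ne_root_of_mem_children h, parentOrRoot_of_mem hT h⟩, ?_⟩
  rintro ⟨hj, rfl⟩
  rw [parentOrRoot_of_ne hT hj]
  exact mem_children_parent hT hj

/-- The vertex sets that contain `i` and, with each vertex other than `i`, its parent. -/
def IsRootedAt (T : SimpleGraph V) (r i : V) (A : Finset V) : Prop :=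
  i ∈ A ∧ ∀ k ∈ A, k ≠ i → ∃ l ∈ A, k ∈ children T r l

/-- Climbing from `k` through parents stays in `A` and lowers the depth, so it can only stop at `i`.
-/
lemma IsRootedAt.dist_lt {A : Finset V} (hA : IsRootedAt T r i A) (hk : k ∈ A) (hki : k ≠ i) :
    T.dist r i < T.dist r k := by
  induction h : T.dist r k using Nat.strong_induction_on generalizing k with
  | _ n ih =>
    obtain ⟨l, hl, hkl⟩ := hA.2 k hk hki
    have hd := dist_of_mem_children hkl
    by_cases hli : l = i
    · subst hli; omega
    · have := ih _ (by omega) hl hli rfl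
      omega

lemma IsRootedAt.dist_le {A : Finset V} (hA : IsRootedAt T r i A) (hk : k ∈ A) :
    T.dist r i ≤ T.dist r k := by
  by_cases hki : k = i
  · rw [hki]
  · exact (hA.dist_lt hk hki).le

lemma IsRootedAt.root_unique {A : Finset V} (hA : IsRootedAt T r i A) (hB : IsRootedAt T r j A) :
    i = j := by
  by_contra h
  have h1 := hA.dist_lt hB.1 (Ne.symm h)
  have h2 := hB.dist_lt hA.1 h
  omega

/-- A path that does not visit the parent of its first vertex descends the tree. -/
lemma exists_parent_mem_support (hT : T.IsTree) {u v : V} (p : T.Walk u v) (hp : p.IsPath)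
    (hu : ∀ x ∈ p.support, u ∉ children T r x) :
    u = v ∨ ∃ x ∈ p.support, v ∈ children T r x := by
  induction p with
  | nil => exact Or.inl rfl
  | @cons u w v h q ih =>
    rw [SimpleGraph.Walk.cons_isPath_iff] at hp
    have hw : w ∈ children T r u := by
      rcases mem_children_or_of_adj hT r h with h' | h'
      · exact h'
      · exact absurd h' (hu w (by simp))
    right
    -- The path never returns to `u`, the only parent of `w`, so the tail starting at `w` again
    -- avoids the parent of its first vertex.
    rcases ih hp.1 (fun x hx hwx => hp.2 (eq_of_mem_children hT hw hwx ▸ hx)) with rfl | ⟨x, hx, hvx⟩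
    · exact ⟨u, by simp, hw⟩
    · exact ⟨x, by simp [hx], hvx⟩

/-- The top is a vertex of minimal depth in `A`. Its parent is outside `A`, so a path inside `A`
from the top can only descend. -/
lemma exists_isRootedAt_of_connected (hT : T.IsTree) (r : V) {A : Finset V}
    (hA : (T.induce (A : Set V)).Connected) : ∃ i, IsRootedAt T r i A := by
  obtain ⟨x⟩ := hA.nonempty
  obtain ⟨i, hi, hmin⟩ := A.exists_min_image (T.dist r) ⟨x, x.2⟩
  refine ⟨i, hi, fun k hk hki => ?_⟩
  classical
  obtain ⟨p⟩ := hA.preconnected ⟨i, hi⟩ ⟨k, hk⟩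
  have hinj : Function.Injective (SimpleGraph.Embedding.induce (G := T) (A : Set V)).toHom :=
    (SimpleGraph.Embedding.induce (G := T) (A : Set V)).injective
  let q := p.toPath.1.map (SimpleGraph.Embedding.induce (G := T) (A : Set V)).toHom
  have hq : q.IsPath := SimpleGraph.Walk.IsPath.map hinj p.toPath.2
  have hqA : ∀ x ∈ q.support, x ∈ A := by
    intro x hx
    simp only [q, SimpleGraph.Walk.support_map, List.mem_map] at hx
    obtain ⟨y, -, rfl⟩ := hx
    exact y.2
  rcases exists_parent_mem_support (r := r) hT q hq (fun x hx hix => by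
    have h1 := hmin x (hqA x hx)
    have h2 := dist_of_mem_children hix
    change T.dist r i = _ at h2
    omega) with h | ⟨x, hx, hkx⟩
  · exact absurd h.symm hki
  · exact ⟨x, hqA x hx, hkx⟩

/-- Acyclicity is inherited from `T`; connectedness holds because every vertex climbs to `i` inside
`A`. -/
lemma IsRootedAt.isTree_induce (hT : T.IsTree) {A : Finset V} (hA : IsRootedAt T r i A) :
    (T.induce (A : Set V)).IsTree := by
  refine ⟨?_, hT.isAcyclic.induce _⟩
  have key : ∀ n, ∀ k (hk : k ∈ A), T.dist r k = n →
      (T.induce (A : Set V)).Reachable ⟨i, hA.1⟩ ⟨k, hk⟩ := by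
    intro n
    induction n with
    | zero =>
      intro k hk hd
      by_cases hki : k = i
      · subst hki; rfl
      · have := hA.dist_lt hk hki
        omega
    | succ n ih =>
      intro k hk hd
      by_cases hki : k = i
      · subst hki; rfl
      · obtain ⟨l, hl, hkl⟩ := hA.2 k hk hki
        have hd' := dist_of_mem_children hkl
        refine (ih l hl (by omega)).trans (SimpleGraph.Adj.reachable ?_)
        exact (mem_children.1 hkl).1
  have : Nonempty (A : Set V) := ⟨⟨i, hA.1⟩⟩
  exact ⟨fun x y => (key _ x.1 x.2 rfl).symm.trans (key _ y.1 y.2 rfl)⟩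

lemma isTree_induce_iff (hT : T.IsTree) (r : V) {A : Finset V} :
    (T.induce (A : Set V)).IsTree ↔ ∃ i, IsRootedAt T r i A :=
  ⟨fun h => exists_isRootedAt_of_connected hT r h.connected, fun ⟨_, h⟩ => h.isTree_induce hT⟩

open Classical in
lemma sum_subtrees_eq (hT : T.IsTree) (r : V) (f : Finset V → ℝ) :
    ∑ A ∈ subtrees T, f A = ∑ i, ∑ A with IsRootedAt T r i A, f A := by
  have h : subtrees T = Finset.univ.biUnion
      fun i => Finset.univ.filter fun A => IsRootedAt T r i A := by
    ext A
    simp [subtrees, isTree_induce_iff hT r]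
  rw [h, Finset.sum_biUnion]
  intro i _ j _ hij
  refine Finset.disjoint_left.2 fun A hA hB => hij ?_
  simp only [Finset.mem_filter, Finset.mem_univ, true_and] at hA hB
  exact hA.root_unique hB

open Classical in
/-- Expanding the factors of the vertices at depth `m` replaces the rooted sets of depth at most
`m` by those of depth at most `m + 1`. -/
lemma sum_isRootedAt_depth_succ (hT : T.IsTree) (r i : V) (u G : V → ℝ)
    (hG : ∀ k, G k = u k * ∏ j ∈ children T r k, (1 + G j)) {m : ℕ} (hm : T.dist r i ≤ m) :
    ∑ A with IsRootedAt T r i A ∧ ∀ k ∈ A, T.dist r k ≤ m,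
      ∏ k ∈ A, (if T.dist r k = m then G k else u k) =
    ∑ A with IsRootedAt T r i A ∧ ∀ k ∈ A, T.dist r k ≤ m + 1,
      ∏ k ∈ A, (if T.dist r k = m + 1 then G k else u k) := by
  let N : Finset V → Finset V := fun A => (A.filter fun k => T.dist r k = m).biUnion (children T r)
  have hN : ∀ A j, j ∈ N A ↔ ∃ k ∈ A, T.dist r k = m ∧ j ∈ children T r k := by
    intro A j; simp [N, and_assoc]
  have hNd : ∀ A j, j ∈ N A → T.dist r j = m + 1 := by
    intro A j hj
    obtain ⟨k, -, h1, h2⟩ := (hN A j).1 hj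
    have := dist_of_mem_children h2
    omega
  have expand : ∀ A : Finset V, ∏ k ∈ A, (if T.dist r k = m then G k else u k) =
      ∑ B ∈ (N A).powerset, (∏ k ∈ A, u k) * ∏ j ∈ B, G j := by
    intro A
    rw [← Finset.mul_sum, ← Finset.prod_one_add, Finset.prod_biUnion, Finset.prod_filter,
      ← Finset.prod_mul_distrib]
    · refine Finset.prod_congr rfl fun k _ => ?_
      split_ifs
      · exact hG k
      · simp
    · intro x _ y _ hxy
      exact Finset.disjoint_left.2 fun z hz hz' => hxy (eq_of_mem_children hT hz hz')
  simp_rw [expand]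
  rw [Finset.sum_sigma']
  -- A rooted set of depth at most `m + 1` is its part `A` of depth at most `m` together with its
  -- bottom layer `B`, an arbitrary subset of the children of the depth-`m` vertices of `A`.
  refine Finset.sum_bij' (fun p _ => p.1 ∪ p.2)
    (fun A _ => ⟨A.filter fun k => T.dist r k ≤ m, A.filter fun k => T.dist r k = m + 1⟩)
    ?_ ?_ ?_ ?_ ?_
  · rintro ⟨A, B⟩ h
    simp only [Finset.mem_sigma, Finset.mem_filter, Finset.mem_univ, true_and,
      Finset.mem_powerset] at h ⊢
    obtain ⟨⟨hA, hAm⟩, hB⟩ := h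
    refine ⟨⟨Finset.mem_union_left _ hA.1, fun k hk hki => ?_⟩, fun k hk => ?_⟩
    · rcases Finset.mem_union.1 hk with hk | hk
      · obtain ⟨l, hl, hkl⟩ := hA.2 k hk hki
        exact ⟨l, Finset.mem_union_left _ hl, hkl⟩
      · obtain ⟨l, hl, -, hkl⟩ := (hN A k).1 (hB hk)
        exact ⟨l, Finset.mem_union_left _ hl, hkl⟩
    · rcases Finset.mem_union.1 hk with hk | hk
      · exact (hAm k hk).trans (Nat.le_succ _)
      · exact (hNd A k (hB hk)).le
  · intro A h
    simp only [Finset.mem_sigma, Finset.mem_filter, Finset.mem_univ, true_and,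
      Finset.mem_powerset] at h ⊢
    obtain ⟨hA, hAm⟩ := h
    refine ⟨⟨⟨Finset.mem_filter.2 ⟨hA.1, hm⟩, fun k hk hki => ?_⟩, fun k hk => hk.2⟩,
      fun k hk => ?_⟩
    · rw [Finset.mem_filter] at hk
      obtain ⟨l, hl, hkl⟩ := hA.2 k hk.1 hki
      have := dist_of_mem_children hkl
      exact ⟨l, Finset.mem_filter.2 ⟨hl, by omega⟩, hkl⟩
    · rw [Finset.mem_filter] at hk
      obtain ⟨l, hl, hkl⟩ := hA.2 k hk.1 (by rintro rfl; omega)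
      have := dist_of_mem_children hkl
      exact (hN _ k).2 ⟨l, Finset.mem_filter.2 ⟨hl, by omega⟩, by omega, hkl⟩
  · rintro ⟨A, B⟩ h
    simp only [Finset.mem_sigma, Finset.mem_filter, Finset.mem_univ, true_and,
      Finset.mem_powerset] at h
    obtain ⟨⟨hA, hAm⟩, hB⟩ := h
    have hBd : ∀ k ∈ B, T.dist r k = m + 1 := fun k hk => hNd A k (hB hk)
    have h1 : (A ∪ B).filter (fun k => T.dist r k ≤ m) = A := by
      ext k; simp only [Finset.mem_filter, Finset.mem_union]
      constructor
      · rintro ⟨h | h, h'⟩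
        · exact h
        · have := hBd k h; omega
      · exact fun h => ⟨Or.inl h, hAm k h⟩
    have h2 : (A ∪ B).filter (fun k => T.dist r k = m + 1) = B := by
      ext k; simp only [Finset.mem_filter, Finset.mem_union]
      constructor
      · rintro ⟨h | h, h'⟩
        · have := hAm k h; omega
        · exact h
      · exact fun h => ⟨Or.inr h, hBd k h⟩
    simp only [h1, h2]
  · intro A h
    simp only [Finset.mem_filter, Finset.mem_univ, true_and] at h
    ext k
    simp only [Finset.mem_filter, Finset.mem_union]
    constructor
    · rintro (h | h) <;> exact h.1
    · intro hk
      have := h.2 k hk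
      by_cases h' : T.dist r k ≤ m
      · exact Or.inl ⟨hk, h'⟩
      · exact Or.inr ⟨hk, by omega⟩
  · rintro ⟨A, B⟩ h
    simp only [Finset.mem_sigma, Finset.mem_filter, Finset.mem_univ, true_and,
      Finset.mem_powerset] at h
    obtain ⟨⟨hA, hAm⟩, hB⟩ := h
    have hBd : ∀ k ∈ B, T.dist r k = m + 1 := fun k hk => hNd A k (hB hk)
    rw [Finset.prod_union]
    · congr 1
      · refine Finset.prod_congr rfl fun k hk => ?_
        have := hAm k hk
        rw [if_neg (by omega)]
      · refine Finset.prod_congr rfl fun k hk => ?_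
        rw [if_pos (hBd k hk)]
    · refine Finset.disjoint_left.2 fun k hk hk' => ?_
      have := hAm k hk
      have := hBd k hk'
      omega

-- At cut-off depth `dist r i` the only set is `{i}`, with value `G i`. Each deeper cut-off leaves
-- the sum unchanged, and past the last layer the cut-off disappears.
open Classical in
lemma sum_isRootedAt_prod (hT : T.IsTree) (r i : V) (u G : V → ℝ)
    (hG : ∀ k, G k = u k * ∏ j ∈ children T r k, (1 + G j)) :
    ∑ A with IsRootedAt T r i A, ∏ k ∈ A, u k = G i := by
  have key : ∀ n, ∑ A with IsRootedAt T r i A ∧ ∀ k ∈ A, T.dist r k ≤ T.dist r i + n,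
      ∏ k ∈ A, (if T.dist r k = T.dist r i + n then G k else u k) = G i := by
    intro n
    induction n with
    | zero =>
      have : (Finset.univ.filter fun A : Finset V => IsRootedAt T r i A ∧
          ∀ k ∈ A, T.dist r k ≤ T.dist r i + 0) = {{i}} := by
        ext A
        simp only [Finset.mem_filter, Finset.mem_univ, true_and, Finset.mem_singleton]
        constructor
        · rintro ⟨hA, hd⟩
          refine Finset.eq_singleton_iff_unique_mem.2 ⟨hA.1, fun k hk => ?_⟩
          by_contra hki
          have h1 := hA.dist_lt hk hki
          have h2 := hd k hk
          omega
        · rintro rfl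
          exact ⟨⟨by simp, by simp +contextual⟩, by simp⟩
      rw [this]
      simp
    | succ n ih =>
      rw [← ih, ← add_assoc]
      exact (sum_isRootedAt_depth_succ hT r i u G hG (Nat.le_add_right _ _)).symm
  -- The `+ 1` puts the cut-off strictly below all vertices even when `i = r`, so no factor `G k`
  -- survives.
  rw [← key (Finset.univ.sup (T.dist r) + 1)]
  have hd : ∀ k, T.dist r k ≤ Finset.univ.sup (T.dist r) := fun k =>
    Finset.le_sup (Finset.mem_univ k)
  refine Finset.sum_congr (Finset.filter_congr fun A _ => ?_) fun A _ => ?_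
  · refine ⟨fun h => ⟨h, fun k _ => ?_⟩, fun h => h.1⟩
    have := hd k
    omega
  · refine Finset.prod_congr rfl fun k _ => ?_
    have := hd k
    rw [if_neg (by omega)]

end Combinatorics

/-! ### The energy as a linear function of the image coordinates -/

section Energy

variable {V : Type*} [Fintype V] {T : SimpleGraph V} {r i j k : V}

lemma IsRootedAt.notMem_children {A : Finset V} (hA : IsRootedAt T r i A) (hk : k ∈ A) :
    i ∉ children T r k := fun h => by
  have h1 := hA.dist_le hk
  have h2 := dist_of_mem_children h
  omega

lemma IsRootedAt.mem_children_parentOrRoot (hT : T.IsTree) {A : Finset V}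
    (hA : IsRootedAt T r i A) (hk : k ∈ A) (hki : k ≠ i) :
    parentOrRoot hT r k ∈ A ∧ k ∈ children T r (parentOrRoot hT r k) := by
  obtain ⟨l, hl, hkl⟩ := hA.2 k hk hki
  rw [parentOrRoot_of_mem hT hkl]
  exact ⟨hl, hkl⟩

open Classical in
lemma IsRootedAt.prod_filter_mem_children (hT : T.IsTree) {A : Finset V}
    (hA : IsRootedAt T r i A) (hk : k ∈ A) (f : V → ℝ) :
    ∏ l ∈ A with k ∈ children T r l, f l = if k = i then 1 else f (parentOrRoot hT r k) := by
  split_ifs with hki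
  · subst hki
    rw [Finset.filter_false_of_mem fun l hl => hA.notMem_children hl, Finset.prod_empty]
  · obtain ⟨h1, h2⟩ := hA.mem_children_parentOrRoot hT hk hki
    have : (A.filter fun l => k ∈ children T r l) = {parentOrRoot hT r k} := by
      ext l
      simp only [Finset.mem_filter, Finset.mem_singleton]
      refine ⟨fun h => (parentOrRoot_of_mem hT h.2).symm, ?_⟩
      rintro rfl
      exact ⟨h1, h2⟩
    rw [this, Finset.prod_singleton]

-- Each edge of the subtree counts once at either end, and edges are indexed by their lower endpoint
-- `k ≠ i`.
open Classical in
lemma IsRootedAt.prod_pow_degIn (hT : T.IsTree) {A : Finset V}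
    (hA : IsRootedAt T r i A) (f : V → ℝ) :
    ∏ k ∈ A, f k ^ degIn T A k =
      ∏ k ∈ A, if k = i then 1 else f (parentOrRoot hT r k) * f k := by
  have hsplit : ∀ k ∈ A, f k ^ degIn T A k =
      (∏ l ∈ A with l ∈ children T r k, f k) * ∏ l ∈ A with k ∈ children T r l, f k := by
    intro k _
    rw [← Finset.prod_union]
    · rw [degIn, ← Finset.prod_const]
      refine Finset.prod_congr ?_ fun _ _ => rfl
      ext l
      simp only [Finset.mem_filter, Finset.mem_union, ← and_or_left]
      refine and_congr_right fun _ => ⟨fun h => mem_children_or_of_adj hT r h.symm, ?_⟩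
      rintro (h | h)
      · exact (mem_children.1 h).1.symm
      · exact (mem_children.1 h).1
    · refine Finset.disjoint_left.2 fun l hl hl' => ?_
      have h1 := dist_of_mem_children (Finset.mem_filter.1 hl).2
      have h2 := dist_of_mem_children (Finset.mem_filter.1 hl').2
      omega
  rw [Finset.prod_congr rfl hsplit, Finset.prod_mul_distrib]
  simp_rw [Finset.prod_filter]
  -- Exchanging the double product transfers the factors for children from the parent to the child.
  rw [Finset.prod_comm, ← Finset.prod_mul_distrib]
  refine Finset.prod_congr rfl fun k hk => ?_
  rw [← Finset.prod_filter, ← Finset.prod_filter, hA.prod_filter_mem_children hT hk,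
    hA.prod_filter_mem_children hT hk]
  split_ifs <;> simp

open Classical in
lemma IsRootedAt.prod_edgesIn (hT : T.IsTree) {A : Finset V} (C : TreeMatrix T)
    (hA : IsRootedAt T r i A) :
    ∏ e ∈ edgesIn T A, C.edgeWeight e =
      ∏ k ∈ A, if k = i then 1 else C.c (parentOrRoot hT r k) k := by
  rw [← Finset.prod_erase A (a := i) (by simp)]
  symm
  refine Finset.prod_bij (fun k _ => s(parentOrRoot hT r k, k)) ?_ ?_ ?_ ?_
  · intro k hk
    obtain ⟨hki, hk⟩ := Finset.mem_erase.1 hk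
    obtain ⟨h1, h2⟩ := hA.mem_children_parentOrRoot hT hk hki
    simp [edgesIn, (mem_children.1 h2).1, h1, hk]
  · intro k hk l hl h
    obtain ⟨hki, hk⟩ := Finset.mem_erase.1 hk
    obtain ⟨hli, hl⟩ := Finset.mem_erase.1 hl
    have h1 := dist_of_mem_children (hA.mem_children_parentOrRoot hT hk hki).2
    have h2 := dist_of_mem_children (hA.mem_children_parentOrRoot hT hl hli).2
    rcases Sym2.eq_iff.1 h with h | h
    · exact h.2
    -- In the swapped case each of `k`, `l` would be the parent of the other, against their depths.
    · rw [h.1] at h1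
      rw [← h.2] at h2
      omega
  · intro e he
    induction e using Sym2.inductionOn with
    | _ u v =>
      simp only [edgesIn, Finset.mem_filter, SimpleGraph.mem_edgeFinset,
        SimpleGraph.mem_edgeSet, Sym2.mem_iff, forall_eq_or_imp, forall_eq] at he
      obtain ⟨hadj, hu, hv⟩ := he
      rcases mem_children_or_of_adj hT r hadj with h | h
      · refine ⟨v, Finset.mem_erase.2 ⟨?_, hv⟩, by rw [parentOrRoot_of_mem hT h]⟩
        rintro rfl
        exact hA.notMem_children hu h
      · refine ⟨u, Finset.mem_erase.2 ⟨?_, hu⟩, by rw [parentOrRoot_of_mem hT h, Sym2.eq_swap]⟩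
        rintro rfl
        exact hA.notMem_children hv h
  · intro k hk
    rw [if_neg (Finset.mem_erase.1 hk).1]
    rfl

open Classical in
/-- The normalized weight of the edge from `k` to its parent. -/
def parentWeight (hT : T.IsTree) (C : TreeMatrix T) (r k : V) : ℝ :=
  if k = r then 1 else
    C.c (parentOrRoot hT r k) k / (C.c (parentOrRoot hT r k) (parentOrRoot hT r k) * C.c k k)

lemma parentWeight_pos (hT : T.IsTree) (C : TreeMatrix T) (r k : V) :
    0 < parentWeight hT C r k := by
  rw [parentWeight]
  split_ifs with h
  · exact one_pos
  · have := (mem_children_iff (j := k) hT).2 ⟨h, rfl⟩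
    exact div_pos (C.edge_pos _ _ (mem_children.1 this).1)
      (mul_pos (C.diag_pos _) (C.diag_pos _))

lemma parentWeight_of_mem (hT : T.IsTree) (C : TreeMatrix T) (h : j ∈ children T r i) :
    parentWeight hT C r j = C.c i j / (C.c i i * C.c j j) := by
  rw [parentWeight, if_neg (ne_root_of_mem_children h), parentOrRoot_of_mem hT h]

-- Splitting `c ^ (-(deg - 1))` as `c * c ^ (-deg)` leaves one factor `c_{p,k} / (c_p c_k)` per
-- edge. The top has no parent edge in `A`; its weight is inserted and divided out so that the
-- product is uniform over `A`, as `sum_isRootedAt_prod` requires.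
open Classical in
lemma IsRootedAt.subtree_weight (hT : T.IsTree) {A : Finset V} (C : TreeMatrix T)
    (hA : IsRootedAt T r i A) (x : V → ℝ) :
    (∏ k ∈ A, x k / C.c k k ^ ((degIn T A k : ℤ) - 1)) * ∏ e ∈ edgesIn T A, C.edgeWeight e =
      (parentWeight hT C r i)⁻¹ * ∏ k ∈ A, parentWeight hT C r k * (C.c k k * x k) := by
  have h1 : ∀ k ∈ A, x k / C.c k k ^ ((degIn T A k : ℤ) - 1) =
      (C.c k k * x k) / C.c k k ^ degIn T A k := by
    intro k _
    have := (C.diag_pos k).ne'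
    rw [zpow_sub_one₀ this, zpow_natCast]
    field_simp
  have h2 : parentWeight hT C r i * ∏ k ∈ A, (if k = i then 1 else parentWeight hT C r k) =
      ∏ k ∈ A, parentWeight hT C r k := by
    rw [← Finset.prod_erase A (a := i) (by simp), ← Finset.mul_prod_erase A _ hA.1]
    congr 1
    exact Finset.prod_congr rfl fun k hk => if_neg (Finset.mem_erase.1 hk).1
  rw [Finset.prod_congr rfl h1, Finset.prod_div_distrib, hA.prod_pow_degIn hT, hA.prod_edgesIn hT,
    Finset.prod_mul_distrib (f := fun k => parentWeight hT C r k), ← h2, ← mul_assoc, ← mul_assoc,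
    inv_mul_cancel₀ (parentWeight_pos hT C r i).ne', one_mul, div_mul_eq_mul_div, mul_div_assoc,
    ← Finset.prod_div_distrib, mul_comm]
  congr 1
  refine Finset.prod_congr rfl fun k hk => ?_
  split_ifs with hki
  · simp
  · rw [parentWeight, if_neg]
    exact ne_root_of_mem_children (hA.mem_children_parentOrRoot hT hk hki).2

/-- The energy is the sum over all vertices `i` of `c_i s_{i,(r)}`. -/
theorem treeEnergy_eq_sum_phi (hT : T.IsTree) (C : TreeMatrix T) (r : V) (x : V → ℝ) :
    treeEnergy T C x = ∑ i, C.c i i * phi T C r x i := by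
  classical
  rw [treeEnergy, sum_subtrees_eq hT r]
  refine Finset.sum_congr rfl fun i _ => ?_
  -- Since `parentWeight` of a child `j` times `c_j` is `c_{k,j} / c_k`, this normalization removes
  -- all coefficients from the recursion.
  have hG : ∀ k, parentWeight hT C r k * (C.c k k * phi T C r x k) =
      parentWeight hT C r k * (C.c k k * x k) *
        ∏ j ∈ children T r k, (1 + parentWeight hT C r j * (C.c j j * phi T C r x j)) := by
    intro k
    rw [phi_eq, ← mul_assoc (C.c k k), ← mul_assoc]
    congr 1
    refine Finset.prod_congr rfl fun j hj => ?_
    rw [parentWeight_of_mem hT C hj]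
    have h1 := (C.diag_pos k).ne'
    have h2 := (C.diag_pos j).ne'
    field_simp
  have hsum := sum_isRootedAt_prod hT r i (fun k => parentWeight hT C r k * (C.c k k * x k)) _ hG
  rw [← inv_mul_cancel_left₀ (parentWeight_pos hT C r i).ne' (C.c i i * phi T C r x i), ← hsum,
    Finset.mul_sum]
  refine Finset.sum_congr rfl fun A hA => ?_
  exact (Finset.mem_filter.1 hA).2.subtree_weight hT C x

end Energy

/-! ### The inverse of `Φ_r`, its Jacobian and the factorized density -/

section ChangeOfVariables

variable {V : Type*} [Fintype V] {T : SimpleGraph V} {r i j k : V}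

lemma children_induction {P : V → Prop} (T : SimpleGraph V) (r : V)
    (h : ∀ i, (∀ j ∈ children T r i, P j) → P i) (i : V) : P i := by
  induction hn : Finset.univ.sup (T.dist r) - T.dist r i using Nat.strong_induction_on
    generalizing i with
  | _ n ih =>
    refine h i fun j hj => ih _ ?_ j rfl
    have h1 := dist_of_mem_children hj
    have h2 : T.dist r j ≤ Finset.univ.sup (T.dist r) := Finset.le_sup (Finset.mem_univ j)
    omega

/-- The factor by which `Φ_r` multiplies the coordinate `i`, in terms of the image point. -/
def childFactor (T : SimpleGraph V) (C : TreeMatrix T) (r : V) (y : V → ℝ) (i : V) : ℝ :=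
  ∏ j ∈ children T r i, (1 + C.c i j / C.c i i * y j)

/-- The inverse of `Φ_r` on the positive orthant. -/
def phiInv (T : SimpleGraph V) (C : TreeMatrix T) (r : V) (y : V → ℝ) (i : V) : ℝ :=
  y i * (childFactor T C r y i)⁻¹

lemma phi_eq_mul_childFactor (C : TreeMatrix T) (s : V → ℝ) :
    phi T C r s i = s i * childFactor T C r (phi T C r s) i :=
  phi_eq T C r s i

lemma ratio_pos (C : TreeMatrix T) (h : j ∈ children T r i) : 0 < C.c i j / C.c i i :=
  div_pos (C.edge_pos _ _ (mem_children.1 h).1) (C.diag_pos _)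

lemma childFactor_pos (C : TreeMatrix T) {y : V → ℝ} (hy : ∀ j ∈ children T r i, 0 < y j) :
    0 < childFactor T C r y i :=
  Finset.prod_pos fun j hj => add_pos one_pos (mul_pos (ratio_pos C hj) (hy j hj))

lemma phi_pos (C : TreeMatrix T) {s : V → ℝ} (hs : ∀ i, 0 < s i) (i : V) :
    0 < phi T C r s i := by
  induction i using children_induction T r with
  | _ i ih =>
    rw [phi_eq_mul_childFactor]
    exact mul_pos (hs i) (childFactor_pos C ih)

lemma phiInv_pos (C : TreeMatrix T) {y : V → ℝ} (hy : ∀ i, 0 < y i) (i : V) :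
    0 < phiInv T C r y i :=
  mul_pos (hy i) (inv_pos.2 (childFactor_pos C fun j _ => hy j))

lemma phiInv_phi (C : TreeMatrix T) {s : V → ℝ} (hs : ∀ i, 0 < s i) :
    phiInv T C r (phi T C r s) = s := by
  funext i
  rw [phiInv, phi_eq_mul_childFactor, mul_inv_cancel_right₀]
  exact (childFactor_pos C fun j _ => phi_pos C hs j).ne'

lemma phi_phiInv (C : TreeMatrix T) {y : V → ℝ} (hy : ∀ i, 0 < y i) :
    phi T C r (phiInv T C r y) = y := by
  funext i
  induction i using children_induction T r with
  | _ i ih =>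
    have h : childFactor T C r (phi T C r (phiInv T C r y)) i = childFactor T C r y i :=
      Finset.prod_congr rfl fun j hj => by rw [ih j hj]
    rw [phi_eq_mul_childFactor, h, phiInv, inv_mul_cancel_right₀]
    exact (childFactor_pos C fun j _ => hy j).ne'

lemma phiInv_image_orthant (C : TreeMatrix T) (r : V) :
    phiInv T C r '' {y | ∀ i, 0 < y i} = {s | ∀ i, 0 < s i} := by
  ext s
  constructor
  · rintro ⟨y, hy, rfl⟩
    exact phiInv_pos C hy
  · exact fun hs => ⟨phi T C r s, phi_pos C hs, phiInv_phi C hs⟩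

lemma phiInv_injOn (C : TreeMatrix T) (r : V) :
    Set.InjOn (phiInv T C r) {y | ∀ i, 0 < y i} := fun y hy z hz h => by
  rw [← phi_phiInv (r := r) C hy, h, phi_phiInv C hz]

lemma measurable_phi (T : SimpleGraph V) (C : TreeMatrix T) (r : V) : Measurable (phi T C r) := by
  refine measurable_pi_lambda _ fun i => ?_
  induction i using children_induction T r with
  | _ i ih =>
    simp_rw [phi_eq (i := i)]
    exact (measurable_pi_apply i).mul
      (Finset.measurable_prod _ fun j hj => ((ih j hj).const_mul _).const_add _)

lemma differentiable_childFactor (C : TreeMatrix T) :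
    Differentiable ℝ fun y => childFactor T C r y i := by
  unfold childFactor
  fun_prop

lemma differentiableAt_phiInv (C : TreeMatrix T) {y : V → ℝ} (hy : ∀ i, 0 < y i) :
    DifferentiableAt ℝ (phiInv T C r) y := by
  refine differentiableAt_pi.2 fun i => ?_
  exact (differentiableAt_apply i y).mul
    ((differentiable_childFactor C y).inv (childFactor_pos C fun j _ => hy j).ne')

open Classical in
lemma childFactor_add_single (C : TreeMatrix T) (y : V → ℝ) (t : ℝ) (hj : j ∉ children T r i) :
    childFactor T C r (y + t • Pi.single j 1) i = childFactor T C r y i := by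
  refine Finset.prod_congr rfl fun k hk => ?_
  have : k ≠ j := by rintro rfl; exact hj hk
  simp [this]

-- Moving along a coordinate that is not a child of `i` leaves the child factor of `i` fixed, so
-- component `i` is linear in `y i` along that line.
open Classical in
lemma fderiv_phiInv_single (C : TreeMatrix T) {y : V → ℝ} (hy : ∀ i, 0 < y i)
    (hj : j ∉ children T r i) :
    fderiv ℝ (phiInv T C r) y (Pi.single j 1) i =
      if i = j then (childFactor T C r y i)⁻¹ else 0 := by
  have hd := differentiableAt_phiInv (r := r) C hy
  have h1 : fderiv ℝ (phiInv T C r) y (Pi.single j 1) i =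
      fderiv ℝ (fun y => phiInv T C r y i) y (Pi.single j 1) := by
    rw [fderiv_apply hd]
    rfl
  rw [h1, ← (differentiableAt_pi.1 hd i).lineDeriv_eq_fderiv, lineDeriv]
  simp only [phiInv, childFactor_add_single C y _ hj, Pi.add_apply, Pi.smul_apply, smul_eq_mul]
  by_cases hij : i = j
  · subst hij
    simp
  · simp [hij]

/-- The matrix is block triangular for the depth `d`, and within one depth the block is diagonal. -/
lemma det_eq_prod_diag_of_depth [DecidableEq V] (M : Matrix V V ℝ) (d : V → ℕ)
    (hM : ∀ i j, i ≠ j → d j ≤ d i → M i j = 0) : M.det = ∏ i, M i i := by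
  have hb : M.BlockTriangular d := fun i j hij => hM i j (by rintro rfl; omega) hij.le
  rw [hb.det, ← Finset.prod_fiberwise_of_maps_to (t := Finset.univ.image d) (g := d)
    (fun i _ => Finset.mem_image_of_mem _ (Finset.mem_univ i))]
  refine Finset.prod_congr rfl fun n _ => ?_
  have hdiag : M.toSquareBlock d n = Matrix.diagonal fun i : {a // d a = n} => M i i := by
    ext i j
    by_cases hij : i = j
    · subst hij
      simp [Matrix.toSquareBlock_def]
    · rw [Matrix.diagonal_apply_ne _ hij]
      exact hM i j (fun h => hij (Subtype.ext h)) (by rw [i.2, j.2])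
  rw [hdiag, Matrix.det_diagonal]
  exact (Finset.prod_subtype _ (by simp) fun i => M i i).symm

lemma det_fderiv_phiInv (C : TreeMatrix T) {y : V → ℝ} (hy : ∀ i, 0 < y i) :
    (fderiv ℝ (phiInv T C r) y).det = ∏ i, (childFactor T C r y i)⁻¹ := by
  classical
  rw [ContinuousLinearMap.det, ← LinearMap.det_toMatrix', det_eq_prod_diag_of_depth _ (T.dist r)]
  · refine Finset.prod_congr rfl fun i _ => ?_
    have hi : i ∉ children T r i := fun h => by
      have := dist_of_mem_children h
      omega
    have := fderiv_phiInv_single C hy hi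
    rw [if_pos rfl] at this
    rw [← this, LinearMap.toMatrix'_apply]
    congr
  · intro i j hij hd
    have hj : j ∉ children T r i := fun h => by
      have := dist_of_mem_children h
      omega
    have := fderiv_phiInv_single C hy hj
    rw [if_neg hij] at this
    rw [← this, LinearMap.toMatrix'_apply]
    congr

/-- A product over parent–child pairs is a product over non-root vertices, each having one parent.
-/
lemma prod_children_eq (hT : T.IsTree) [DecidableEq V] (r : V) (f : V → V → ℝ) :
    ∏ i, ∏ j ∈ children T r i, f i j =
      ∏ j, if j = r then 1 else f (parentOrRoot hT r j) j := by
  classical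
  have h : ∀ i, ∏ j ∈ children T r i, f i j =
      ∏ j, if j ≠ r ∧ parentOrRoot hT r j = i then f i j else 1 := by
    intro i
    rw [← Finset.prod_filter]
    exact Finset.prod_congr (by ext j; simp [mem_children_iff hT]) fun _ _ => rfl
  simp_rw [h]
  rw [Finset.prod_comm]
  refine Finset.prod_congr rfl fun j _ => ?_
  by_cases hj : j = r
  · simp [hj]
  · simp [hj]

open Classical in
/-- The ratio `c_{p,i} / c_p`, where `p` is the parent of `i`; zero at the root. -/
def parentRatio (hT : T.IsTree) (C : TreeMatrix T) (r i : V) : ℝ :=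
  if i = r then 0 else
    C.c (parentOrRoot hT r i) i / C.c (parentOrRoot hT r i) (parentOrRoot hT r i)

lemma parentRatio_nonneg (hT : T.IsTree) (C : TreeMatrix T) (r i : V) :
    0 ≤ parentRatio hT C r i := by
  rw [parentRatio]
  split_ifs with h
  · exact le_rfl
  · exact (ratio_pos C ((mem_children_iff hT).2 ⟨h, rfl⟩)).le

/-- The function `x ^ (α - 1) (1 + κ x) ^ (-δ) e ^ (-γ x)` on `(0, ∞)`. -/
def scaledKummerWeight (α δ κ γ x : ℝ) : ℝ :=
  (Set.Ioi (0 : ℝ)).indicator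
    (fun x => x ^ (α - 1) * (1 + κ * x) ^ (-δ) * Real.exp (-(γ * x))) x

/-- Unnormalized density of the component `i` of the image of `TK(a, C)` under `Φ_r`. -/
def componentWeight (hT : T.IsTree) (a : V → ℝ) (C : TreeMatrix T) (r i : V) : ℝ → ℝ :=
  scaledKummerWeight (a i) (a (parentOrRoot hT r i)) (parentRatio hT C r i) (C.c i i)

/-- The tree-Kummer weight factorizes in the image coordinates. -/
lemma jacobian_mul_weight (hT : T.IsTree) (a : V → ℝ) (C : TreeMatrix T) (r : V) {y : V → ℝ}
    (hy : ∀ i, 0 < y i) :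
    |(fderiv ℝ (phiInv T C r) y).det| *
      ((∏ i, phiInv T C r y i ^ (a i - 1)) * Real.exp (-treeEnergy T C (phiInv T C r y))) =
    ∏ i, componentWeight hT a C r i (y i) := by
  classical
  have hF : ∀ i, 0 < childFactor T C r y i := fun i => childFactor_pos C fun j _ => hy j
  -- The Jacobian supplies `F⁻¹` and the power supplies `F ^ (-(a i - 1))`; together they give `F ^
  -- (-a i)`.
  have hpow : ∀ i, (childFactor T C r y i)⁻¹ * phiInv T C r y i ^ (a i - 1) =
      y i ^ (a i - 1) *
        ∏ j ∈ children T r i, (1 + C.c i j / C.c i i * y j) ^ (-a i) := by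
    intro i
    rw [Real.finsetProd_rpow _ _ fun j hj =>
      (add_pos one_pos (mul_pos (ratio_pos C hj) (hy j))).le]
    change _ = _ * childFactor T C r y i ^ (-a i)
    rw [phiInv, Real.mul_rpow (hy i).le (inv_pos.2 (hF i)).le, Real.inv_rpow (hF i).le,
      ← Real.rpow_neg (hF i).le, ← Real.rpow_neg_one, mul_left_comm, ← Real.rpow_add (hF i)]
    congr 2
    ring
  rw [det_fderiv_phiInv C hy, abs_of_pos (Finset.prod_pos fun i _ => inv_pos.2 (hF i)),
    treeEnergy_eq_sum_phi hT C r, phi_phiInv C hy, ← mul_assoc, ← Finset.prod_mul_distrib,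
    Finset.prod_congr rfl fun i _ => hpow i, Finset.prod_mul_distrib,
    prod_children_eq hT r (fun i j => (1 + C.c i j / C.c i i * y j) ^ (-a i)),
    ← Finset.sum_neg_distrib, Real.exp_sum, ← Finset.prod_mul_distrib, ← Finset.prod_mul_distrib]
  refine Finset.prod_congr rfl fun i _ => ?_
  rw [componentWeight, scaledKummerWeight, Set.indicator_of_mem (Set.mem_Ioi.2 (hy i)), parentRatio]
  -- At the root the ratio `0` turns the factor `(1 + κ y) ^ (-δ)` into `1`, whatever `δ` is.
  split_ifs <;> simp

end ChangeOfVariables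

/-! ### Normalized densities and Tonelli for products -/

section Density

variable {X Y : Type*} [MeasurableSpace X] [MeasurableSpace Y]

lemma densityPropTo_apply (ν : Measure X) (f : X → ℝ) {s : Set X} (hs : MeasurableSet s) :
    densityPropTo ν f s =
      (∫⁻ x, ENNReal.ofReal (f x) ∂ν)⁻¹ * ∫⁻ x in s, ENNReal.ofReal (f x) ∂ν := by
  rw [densityPropTo, Measure.smul_apply, withDensity_apply _ hs, smul_eq_mul]

lemma isProbabilityMeasure_densityPropTo {ν : Measure X} {f : X → ℝ}
    (h0 : ∫⁻ x, ENNReal.ofReal (f x) ∂ν ≠ 0) (htop : ∫⁻ x, ENNReal.ofReal (f x) ∂ν ≠ ∞) :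
    IsProbabilityMeasure (densityPropTo ν f) :=
  ⟨by rw [densityPropTo_apply _ _ .univ, Measure.restrict_univ, ENNReal.inv_mul_cancel h0 htop]⟩

lemma densityPropTo_congr_ae {ν : Measure X} {f g : X → ℝ} (h : f =ᵐ[ν] g) :
    densityPropTo ν f = densityPropTo ν g := by
  have h' : (fun x => ENNReal.ofReal (f x)) =ᵐ[ν] fun x => ENNReal.ofReal (g x) :=
    h.fun_comp ENNReal.ofReal
  rw [densityPropTo, densityPropTo, lintegral_congr_ae h', withDensity_congr_ae h']

/-- The normalization absorbs constants, so those from rescaling need no tracking. -/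
lemma densityPropTo_smul_measure (ν : Measure X) (f : X → ℝ) {c : ℝ≥0∞} (h0 : c ≠ 0)
    (htop : c ≠ ∞) : densityPropTo (c • ν) f = densityPropTo ν f := by
  rw [densityPropTo, densityPropTo, lintegral_smul_measure, withDensity_smul_measure, smul_smul,
    smul_eq_mul, ENNReal.mul_inv (Or.inl h0) (Or.inl htop), mul_right_comm,
    ENNReal.inv_mul_cancel h0 htop, one_mul]

lemma densityPropTo_const_mul (ν : Measure X) (f : X → ℝ) {c : ℝ} (hc : 0 < c) :
    densityPropTo ν (fun x => c * f x) = densityPropTo ν f := by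
  have h : ∀ x, ENNReal.ofReal (c * f x) = ENNReal.ofReal c * ENNReal.ofReal (f x) := fun x =>
    ENNReal.ofReal_mul hc.le
  rw [← densityPropTo_smul_measure ν f (ENNReal.ofReal_pos.2 hc).ne' ENNReal.ofReal_ne_top,
    densityPropTo, densityPropTo, lintegral_smul_measure, withDensity_smul_measure]
  simp_rw [h]
  rw [lintegral_const_mul' _ _ ENNReal.ofReal_ne_top]
  congr 1
  exact withDensity_smul' _ _ ENNReal.ofReal_ne_top

lemma map_densityPropTo_comp (ν : Measure X) {e : X → Y} (he : Measurable e) {g : Y → ℝ}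
    (hg : Measurable g) :
    (densityPropTo ν (g ∘ e)).map e = densityPropTo (ν.map e) g := by
  ext s hs
  rw [Measure.map_apply he hs, densityPropTo_apply _ _ (he hs), densityPropTo_apply _ _ hs,
    lintegral_map hg.ennreal_ofReal he, setLIntegral_map hs hg.ennreal_ofReal he]
  rfl

lemma map_mul_left_densityPropTo {κ : ℝ} (hκ : 0 < κ) {g : ℝ → ℝ} (hg : Measurable g) :
    (densityPropTo volume fun x => g (κ * x)).map (fun x => κ * x) = densityPropTo volume g := by
  have h := map_densityPropTo_comp volume (measurable_const_mul κ) hg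
  rw [show (volume : Measure ℝ).map (fun x => κ * x) = _ from Real.map_volume_mul_left hκ.ne',
    densityPropTo_smul_measure _ _ (ENNReal.ofReal_pos.2 (abs_pos.2 (inv_pos.2 hκ).ne')).ne'
      ENNReal.ofReal_ne_top] at h
  exact h

lemma lintegral_fin_prod {n : ℕ} {E : Fin n → Type*} {mE : ∀ i, MeasurableSpace (E i)}
    {μ : (i : Fin n) → Measure (E i)} [∀ i, SigmaFinite (μ i)]
    {f : (i : Fin n) → E i → ℝ≥0∞} (hf : ∀ i, Measurable (f i)) :
    ∫⁻ x, ∏ i, f i (x i) ∂(Measure.pi μ) = ∏ i, ∫⁻ x, f i x ∂(μ i) := by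
  induction n with
  | zero => simp
  | succ n ih =>
    rw [← ((measurePreserving_piFinSuccAbove μ 0).symm).lintegral_comp_emb
      (MeasurableEquiv.measurableEmbedding _)]
    simp_rw [MeasurableEquiv.piFinSuccAbove_symm_apply, Fin.insertNthEquiv,
      Fin.prod_univ_succ, Fin.insertNth_zero]
    simp only [Fin.zero_succAbove]
    rw [← ih fun i => hf i.succ, ← lintegral_prod_mul (hf 0).aemeasurable]
    · rfl
    · exact (Finset.measurable_prod _ fun i _ =>
        (hf i.succ).comp (measurable_pi_apply i)).aemeasurable

/-- Tonelli's theorem for a product of functions of one coordinate each. -/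
lemma lintegral_fintype_prod {ι : Type*} [Fintype ι] {E : ι → Type*}
    {mE : ∀ i, MeasurableSpace (E i)} {μ : (i : ι) → Measure (E i)} [∀ i, SigmaFinite (μ i)]
    {f : (i : ι) → E i → ℝ≥0∞} (hf : ∀ i, Measurable (f i)) :
    ∫⁻ x, ∏ i, f i (x i) ∂(Measure.pi μ) = ∏ i, ∫⁻ x, f i x ∂(μ i) := by
  let e := (Fintype.equivFin ι).symm
  rw [← (measurePreserving_piCongrLeft _ e).lintegral_comp_emb
    (MeasurableEquiv.measurableEmbedding _)]
  simp_rw [← e.prod_comp, MeasurableEquiv.coe_piCongrLeft, Equiv.piCongrLeft_apply_apply]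
  exact lintegral_fin_prod fun i => hf _

end Density

/-! ### One-dimensional factors: integrability, Gamma and Kummer laws -/

section Weights

lemma measurable_scaledKummerWeight (α δ κ γ : ℝ) : Measurable (scaledKummerWeight α δ κ γ) := by
  refine Measurable.indicator ?_ measurableSet_Ioi
  fun_prop

lemma measurable_kummerWeight (α β γ : ℝ) : Measurable (kummerWeight α β γ) := by
  refine Measurable.indicator ?_ measurableSet_Ioi
  fun_prop

lemma scaledKummerWeight_pos {α δ κ γ x : ℝ} (hκ : 0 ≤ κ) (hx : 0 < x) :
    0 < scaledKummerWeight α δ κ γ x := by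
  rw [scaledKummerWeight, Set.indicator_of_mem (Set.mem_Ioi.2 hx)]
  positivity

lemma scaledKummerWeight_nonneg {α δ κ γ x : ℝ} (hκ : 0 ≤ κ) :
    0 ≤ scaledKummerWeight α δ κ γ x := by
  by_cases hx : 0 < x
  · exact (scaledKummerWeight_pos hκ hx).le
  · rw [scaledKummerWeight, Set.indicator_of_notMem (by simpa using hx)]

lemma lintegral_scaledKummerWeight_ne_zero {α δ κ γ : ℝ} (hκ : 0 ≤ κ) :
    ∫⁻ x, ENNReal.ofReal (scaledKummerWeight α δ κ γ x) ≠ 0 := by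
  rw [← pos_iff_ne_zero, lintegral_pos_iff_support
    (measurable_scaledKummerWeight α δ κ γ).ennreal_ofReal]
  refine lt_of_lt_of_le ?_ (measure_mono (s := Set.Ioi (0 : ℝ)) fun x hx => ?_)
  · simp
  · exact (ENNReal.ofReal_pos.2 (scaledKummerWeight_pos hκ hx)).ne'

/-- For `δ ≥ 0` the factor `(1 + κ x) ^ (-δ)` is at most `1`; the Gamma integral then bounds the
mass. -/
lemma scaledKummerWeight_le_gammaPDFReal {α δ κ γ : ℝ} (hα : 0 < α) (hδ : 0 ≤ δ) (hκ : 0 ≤ κ)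
    (hγ : 0 < γ) (x : ℝ) :
    scaledKummerWeight α δ κ γ x ≤ Real.Gamma α / γ ^ α * gammaPDFReal α γ x := by
  have hΓ := Real.Gamma_pos_of_pos hα
  by_cases hx : 0 < x
  · rw [scaledKummerWeight, Set.indicator_of_mem (Set.mem_Ioi.2 hx), gammaPDFReal, if_pos hx.le]
    have h1 : (1 + κ * x) ^ (-δ) ≤ 1 :=
      Real.rpow_le_one_of_one_le_of_nonpos (by nlinarith) (by linarith)
    have h2 : Real.Gamma α / γ ^ α * (γ ^ α / Real.Gamma α * x ^ (α - 1) * Real.exp (-(γ * x))) =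
        x ^ (α - 1) * 1 * Real.exp (-(γ * x)) := by
      have := (Real.rpow_pos_of_pos hγ α).ne'
      field_simp
    rw [h2]
    gcongr
  · rw [scaledKummerWeight, Set.indicator_of_notMem (by simpa using hx)]
    exact mul_nonneg (by positivity) (gammaPDFReal_nonneg hα hγ x)

lemma lintegral_scaledKummerWeight_ne_top {α δ κ γ : ℝ} (hα : 0 < α) (hδ : 0 ≤ δ) (hκ : 0 ≤ κ)
    (hγ : 0 < γ) : ∫⁻ x, ENNReal.ofReal (scaledKummerWeight α δ κ γ x) ≠ ∞ := by
  refine ne_top_of_le_ne_top (b := ENNReal.ofReal (Real.Gamma α / γ ^ α)) ENNReal.ofReal_ne_top ?_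
  calc ∫⁻ x, ENNReal.ofReal (scaledKummerWeight α δ κ γ x)
      ≤ ∫⁻ x, ENNReal.ofReal (Real.Gamma α / γ ^ α) * gammaPDF α γ x := by
        refine lintegral_mono fun x => ?_
        rw [gammaPDF, ← ENNReal.ofReal_mul (by have := Real.Gamma_pos_of_pos hα; positivity)]
        exact ENNReal.ofReal_le_ofReal (scaledKummerWeight_le_gammaPDFReal hα hδ hκ hγ x)
    _ = ENNReal.ofReal (Real.Gamma α / γ ^ α) := by
        rw [lintegral_const_mul' _ _ ENNReal.ofReal_ne_top, lintegral_gammaPDF_eq_one hα hγ,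
          mul_one]

lemma densityPropTo_scaledKummerWeight_zero {α δ γ : ℝ} (hα : 0 < α) (hγ : 0 < γ) :
    densityPropTo volume (scaledKummerWeight α δ 0 γ) = gammaMeasure α γ := by
  have hΓ := Real.Gamma_pos_of_pos hα
  have hγα := Real.rpow_pos_of_pos hγ α
  have h : scaledKummerWeight α δ 0 γ =ᵐ[volume]
      fun x => Real.Gamma α / γ ^ α * gammaPDFReal α γ x := by
    -- The point `0` is excluded because `gammaPDFReal` uses `0 ≤ x` while the weight uses `0 < x`.
    filter_upwards [Measure.ae_ne volume (0 : ℝ)] with x hx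
    rw [scaledKummerWeight, gammaPDFReal]
    rcases hx.lt_or_gt with hx | hx
    · rw [if_neg hx.not_ge, Set.indicator_of_notMem (by simpa using hx.le), mul_zero]
    · rw [if_pos hx.le, Set.indicator_of_mem (Set.mem_Ioi.2 hx), zero_mul, add_zero, Real.one_rpow]
      field_simp
  have h1 : ∫⁻ x, ENNReal.ofReal (gammaPDFReal α γ x) = 1 := lintegral_gammaPDF_eq_one hα hγ
  rw [densityPropTo_congr_ae h, densityPropTo_const_mul _ _ (div_pos hΓ hγα), densityPropTo, h1,
    inv_one, one_smul]
  rfl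

lemma map_scaledKummerWeight {α β κ γ : ℝ} (hκ : 0 < κ) :
    (densityPropTo volume (scaledKummerWeight α (α + β) κ γ)).map (fun x => κ * x) =
      kummerMeasure α β (γ / κ) := by
  have h : scaledKummerWeight α (α + β) κ γ =
      fun x => κ⁻¹ ^ (α - 1) * kummerWeight α β (γ / κ) (κ * x) := by
    funext x
    rw [scaledKummerWeight, kummerWeight]
    by_cases hx : 0 < x
    · have hκx := mul_pos hκ hx
      rw [Set.indicator_of_mem (Set.mem_Ioi.2 hx), Set.indicator_of_mem (Set.mem_Ioi.2 hκx),
        Real.rpow_neg (by positivity), ← mul_assoc, ← mul_div_assoc,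
        ← Real.mul_rpow (by positivity) (by positivity), inv_mul_cancel_left₀ hκ.ne',
        div_eq_mul_inv]
      congr 3
      field_simp
    · have hκx : ¬ 0 < κ * x := fun h => hx (pos_of_mul_pos_right h hκ.le)
      rw [Set.indicator_of_notMem (by simpa using hx), Set.indicator_of_notMem (by simpa using hκx),
        mul_zero]
  rw [h, densityPropTo_const_mul _ _ (by positivity),
    map_mul_left_densityPropTo hκ (measurable_kummerWeight α β (γ / κ)), kummerMeasure]

end Weights

/-! ### The law of the image vector -/

section Law

variable {V : Type*} [Fintype V] {T : SimpleGraph V}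

/-- Change of variables `s = phiInv y` on the orthant. With `g = 1` it computes the normalizing
constant, with the indicator of a box the image measure. -/
lemma lintegral_comp_phi_mul_weight (hT : T.IsTree) (a : V → ℝ) (C : TreeMatrix T) (r : V)
    (g : (V → ℝ) → ℝ≥0∞) :
    ∫⁻ s, g (phi T C r s) * ENNReal.ofReal (treeKummerWeight T a C s) =
      ∫⁻ y, g y * ∏ i, ENNReal.ofReal (componentWeight hT a C r i (y i)) := by
  have hP : MeasurableSet {y : V → ℝ | ∀ i, 0 < y i} := by
    simp_rw [Set.ofPred_forall]
    exact MeasurableSet.iInter fun i => measurableSet_lt measurable_const (measurable_pi_apply i)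
  have hL : (fun s => g (phi T C r s) * ENNReal.ofReal (treeKummerWeight T a C s)) =
      {y : V → ℝ | ∀ i, 0 < y i}.indicator fun s => g (phi T C r s) * ENNReal.ofReal
        ((∏ i, s i ^ (a i - 1)) * Real.exp (-treeEnergy T C s)) := by
    funext s
    by_cases hs : s ∈ {y : V → ℝ | ∀ i, 0 < y i}
    · rw [treeKummerWeight, Set.indicator_of_mem hs, Set.indicator_of_mem hs]
    · rw [treeKummerWeight, Set.indicator_of_notMem hs, Set.indicator_of_notMem hs]
      simp
  have hR : (fun y => g y * ∏ i, ENNReal.ofReal (componentWeight hT a C r i (y i))) =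
      {y : V → ℝ | ∀ i, 0 < y i}.indicator fun y =>
        g y * ∏ i, ENNReal.ofReal (componentWeight hT a C r i (y i)) := by
    funext y
    by_cases hy : y ∈ {y : V → ℝ | ∀ i, 0 < y i}
    · rw [Set.indicator_of_mem hy]
    · rw [Set.indicator_of_notMem hy]
      simp only [Set.mem_ofPred_eq, not_forall] at hy
      obtain ⟨i, hi⟩ := hy
      rw [Finset.prod_eq_zero (Finset.mem_univ i), mul_zero]
      rw [componentWeight, scaledKummerWeight, Set.indicator_of_notMem (by simpa using hi),
        ENNReal.ofReal_zero]
  rw [hL, hR, lintegral_indicator hP, lintegral_indicator hP]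
  conv_lhs => rw [← phiInv_image_orthant C r]
  rw [lintegral_image_eq_lintegral_abs_det_fderiv_mul volume hP
    (fun y hy => (differentiableAt_phiInv C hy).hasFDerivAt.hasFDerivWithinAt)
    (phiInv_injOn C r)]
  refine setLIntegral_congr_fun hP fun y hy => ?_
  rw [phi_phiInv C hy, mul_left_comm, ← ENNReal.ofReal_mul (abs_nonneg _),
    jacobian_mul_weight hT a C r hy, ENNReal.ofReal_prod_of_nonneg]
  exact fun i _ => scaledKummerWeight_nonneg (parentRatio_nonneg hT C r i)

lemma isProbabilityMeasure_component (hT : T.IsTree) {a : V → ℝ} (ha : ∀ i, 0 < a i)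
    (C : TreeMatrix T) (r i : V) :
    IsProbabilityMeasure (densityPropTo volume (componentWeight hT a C r i)) :=
  isProbabilityMeasure_densityPropTo
    (lintegral_scaledKummerWeight_ne_zero (parentRatio_nonneg hT C r i))
    (lintegral_scaledKummerWeight_ne_top (ha i) (ha _).le (parentRatio_nonneg hT C r i)
      (C.diag_pos i))

/-- `Φ_r` maps the tree-Kummer distribution to a product measure. -/
theorem map_phi_treeKummerMeasure (hT : T.IsTree) {a : V → ℝ} (ha : ∀ i, 0 < a i)
    (C : TreeMatrix T) (r : V) :
    (treeKummerMeasure T a C).map (phi T C r) =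
      Measure.pi fun i => densityPropTo volume (componentWeight hT a C r i) := by
  have hprob := isProbabilityMeasure_component hT ha C r
  have hmeas : ∀ i, Measurable fun x => ENNReal.ofReal (componentWeight hT a C r i x) := fun i =>
    (measurable_scaledKummerWeight _ _ _ _).ennreal_ofReal
  have hZ : ∫⁻ s, ENNReal.ofReal (treeKummerWeight T a C s) =
      ∏ i, ∫⁻ x, ENNReal.ofReal (componentWeight hT a C r i x) := by
    have h := lintegral_comp_phi_mul_weight hT a C r fun _ => 1
    simp only [one_mul] at h
    rw [h, volume_pi, lintegral_fintype_prod hmeas]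
  refine (Measure.pi_eq fun s hs => ?_).symm
  have hB : MeasurableSet (Set.univ.pi s) := MeasurableSet.univ_pi hs
  have hbox : ∫⁻ x in phi T C r ⁻¹' Set.univ.pi s, ENNReal.ofReal (treeKummerWeight T a C x) =
      ∏ i, ∫⁻ x in s i, ENNReal.ofReal (componentWeight hT a C r i x) := by
    have h := lintegral_comp_phi_mul_weight hT a C r ((Set.univ.pi s).indicator 1)
    have hl : ∀ x, (Set.univ.pi s).indicator (1 : (V → ℝ) → ℝ≥0∞) (phi T C r x) *
        ENNReal.ofReal (treeKummerWeight T a C x) = (phi T C r ⁻¹' Set.univ.pi s).indicator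
          (fun x => ENNReal.ofReal (treeKummerWeight T a C x)) x := by
      intro x
      by_cases hx : phi T C r x ∈ Set.univ.pi s
      · rw [Set.indicator_of_mem hx, Set.indicator_of_mem (Set.mem_preimage.2 hx), Pi.one_apply,
          one_mul]
      · rw [Set.indicator_of_notMem hx, Set.indicator_of_notMem (by exact hx), zero_mul]
    have hr : ∀ y, (Set.univ.pi s).indicator (1 : (V → ℝ) → ℝ≥0∞) y *
        ∏ i, ENNReal.ofReal (componentWeight hT a C r i (y i)) =
        ∏ i, (s i).indicator (fun x => ENNReal.ofReal (componentWeight hT a C r i x)) (y i) := by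
      intro y
      by_cases hy : y ∈ Set.univ.pi s
      · rw [Set.indicator_of_mem hy, Pi.one_apply, one_mul]
        exact Finset.prod_congr rfl fun i _ => by rw [Set.indicator_of_mem (hy i trivial)]
      · rw [Set.indicator_of_notMem hy, zero_mul]
        simp only [Set.mem_univ_pi, not_forall] at hy
        obtain ⟨i, hi⟩ := hy
        exact (Finset.prod_eq_zero (Finset.mem_univ i) (Set.indicator_of_notMem hi _)).symm
    simp_rw [hl, hr] at h
    rw [lintegral_indicator (measurable_phi T C r hB), volume_pi,
      lintegral_fintype_prod fun i => (hmeas i).indicator (hs i)] at h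
    simp_rw [lintegral_indicator (hs _)] at h
    rw [volume_pi]
    exact h
  rw [Measure.map_apply (measurable_phi T C r) hB, treeKummerMeasure,
    densityPropTo_apply _ _ (measurable_phi T C r hB), hbox, hZ,
    ENNReal.prod_inv_distrib, ← Finset.prod_mul_distrib]
  · exact Finset.prod_congr rfl fun i _ => (densityPropTo_apply _ _ (hs i)).symm
  -- The inverse of a product in `ℝ≥0∞` splits because no component has mass zero.
  · intro i _ j _ _
    exact Or.inl (lintegral_scaledKummerWeight_ne_zero (parentRatio_nonneg hT C r i))

end Law

end TreeKummer

end

theorem theorem3p2 {V : Type*} [Fintype V] (T : SimpleGraph V) (hT : T.IsTree)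
    (hp : 2 ≤ Fintype.card V) (a : V → ℝ) (ha : ∀ i, 0 < a i) (C : TreeKummer.TreeMatrix T)
    {Ω : Type*} [MeasurableSpace Ω] (μ : MeasureTheory.Measure Ω)
    [MeasureTheory.IsProbabilityMeasure μ] (S : Ω → V → ℝ)
    (hS : ProbabilityTheory.HasLaw S (TreeKummer.treeKummerMeasure T a C) μ) (r : V) :
    ProbabilityTheory.iIndepFun (fun i ω => TreeKummer.phi T C r (S ω) i) μ ∧
    ProbabilityTheory.HasLaw (fun ω => TreeKummer.phi T C r (S ω) r)
      (ProbabilityTheory.gammaMeasure (a r) (C.c r r)) μ ∧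
    ∀ (i : V) (hi : i ≠ r) (p : V), p = TreeKummer.parent hT r i hi →
      ProbabilityTheory.HasLaw
        (fun ω => C.c p i / C.c p p * TreeKummer.phi T C r (S ω) i)
        (TreeKummer.kummerMeasure (a i) (a p - a i) (C.c p p * C.c i i / C.c p i)) μ := by
  have hprob := TreeKummer.isProbabilityMeasure_component hT ha C r
  have hphi : ProbabilityTheory.HasLaw (fun ω => TreeKummer.phi T C r (S ω))
      (MeasureTheory.Measure.pi fun i => TreeKummer.densityPropTo MeasureTheory.volume
        (TreeKummer.componentWeight hT a C r i)) μ :=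
    ProbabilityTheory.HasLaw.fun_comp
      ⟨(TreeKummer.measurable_phi T C r).aemeasurable,
        TreeKummer.map_phi_treeKummerMeasure hT ha C r⟩ hS
  have hcomp : ∀ i, ProbabilityTheory.HasLaw (fun ω => TreeKummer.phi T C r (S ω) i)
      (TreeKummer.densityPropTo MeasureTheory.volume (TreeKummer.componentWeight hT a C r i)) μ :=
    fun i => (MeasureTheory.measurePreserving_eval _ i).hasLaw.fun_comp hphi
  refine ⟨(ProbabilityTheory.iIndepFun_iff_hasLaw_pi_pi hcomp).2 hphi, ?_, ?_⟩
  · have h := hcomp r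
    rwa [TreeKummer.componentWeight, TreeKummer.parentRatio, if_pos rfl,
      TreeKummer.densityPropTo_scaledKummerWeight_zero (ha r) (C.diag_pos r)] at h
  · rintro i hi p rfl
    have hratio := TreeKummer.ratio_pos C (TreeKummer.mem_children_parent hT hi)
    refine ProbabilityTheory.HasLaw.fun_comp ⟨(measurable_const_mul _).aemeasurable, ?_⟩ (hcomp i)
    have h := TreeKummer.map_scaledKummerWeight (α := a i)
      (β := a (TreeKummer.parent hT r i hi) - a i) (γ := C.c i i) hratio
    rw [TreeKummer.componentWeight, TreeKummer.parentRatio, if_neg hi,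
      TreeKummer.parentOrRoot_of_ne hT hi]
    -- Parameters match: `a_i + (a_p - a_i) = a_p`, and `c_i / (c_{p,i} / c_p) = c_p c_i / c_{p,i}`.
    rw [add_sub_cancel, div_div_eq_mul_div, mul_comm (C.c i i)] at h
    exact h
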